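/- Let $S^1=\mathbb{R}/2\pi\mathbb{Z}$ be the circle of circumference $2\pi$ with its geodesic (arc length) metric. For subsets $A,B$ of a metric space $Z$, let $d_H(A,B)\in[0,\infty]$ be their Hausdorff distance, i.e. the infimum of all $r\ge 0$ such that $A$ is contained in the open $r$-neighbourhood of $B$ and $B$ in the open $r$-neighbourhood of $A$ ($\infty$ if there is no such $r$). For metric spaces $X,Y$, let $d_{GH}(X,Y)\in[0,\infty]$ be their Gromov–Hausdorff distance, i.e. the infimum of $d_H(\gamma(X),\varphi(Y))$ over all metric spaces $Z$ and all isometric embeddings $\gamma\colon X\to Z$ and $\varphi\colon Y\to Z$. Let $X,Y\subseteq S^1$ be any subsets, equipped with the restriction of the metric of $S^1$. Then (a) $d_{GH}(X,S^1)\ge\min\left\{d_H(X,S^1),\tfrac{\pi}{6}\right\}$; (b) $d_{GH}(X,Y)\ge\min\left\{d_H(X,S^1)-d_H(Y,S^1),\ \tfrac{\pi}{6}-\tfrac12 d_H(Y,S^1)\right\}$. In particular, if $d_{GH}(X,S^1)<\tfrac{\pi}{6}$, then $d_{GH}(X,S^1)=d_H(X,S^1)$. (If $X$ or $Y$ is empty,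 the distances may be $\infty$, and the differences in (b) are taken in $[-\infty,\infty]$ with $\infty-\infty=-\infty$.) -/

import Mathlib

open Set Metric
open scoped Real ENNReal

universe u v

/-- The Gromov--Hausdorff distance, with values in `[0, ∞]`, between two arbitrary (not necessarily
compact, bounded or nonempty) metric spaces `X` and `Y`: the infimum of the Hausdorff distances
between `γ(X)` and `φ(Y)`, over all metric spaces `Z` and all isometric embeddings `γ : X → Z` and
`φ : Y → Z`. Letting `Z` range over `Type (max u v)` loses nothing, because `Z` can always be
replaced by its subspace `γ(X) ∪ φ(Y)`. -/
noncomputable def ghEDist (X : Type u) (Y : Type v) [MetricSpace X] [MetricSpace Y] : ℝ≥0∞ :=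
  ⨅ (Z : Type (max u v)) (_ : MetricSpace Z) (γ : X → Z) (φ : Y → Z)
    (_ : Isometry γ) (_ : Isometry φ), hausdorffEDist (range γ) (range φ)

/-- The circle `ℝ / 2πℤ` of circumference `2π`. Its Mathlib metric is the quotient metric
`dist [s] [t] = min over k : ℤ of |s - t - 2πk|`, that is, the geodesic (arc length) metric. -/
abbrev Circle2Pi : Type := AddCircle (2 * π)

/-! A near-isometric correspondence gives a map from a dense part of the circle to `X` with
distortion below `2 * d`. If its image misses a ball of radius `b + d`, it lies in an arc, hence
lifts to the line. There the signed angle between the source points is a cocycle at scale `2 * (b +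
d)`: three source distances below `2 * π / 3` cannot wind around the circle. On the line it is a
coboundary (`exists_potential`), so its sum along a closed chain vanishes; yet a fine chain going
once around the circle has sum `2 * π`. -/

/-- A real cochain that is additive on `r`-close triples of points of the line is a coboundary on
every finite set of points. -/
theorem exists_potential {ι : Type*} (x : ι → ℝ) (c : ι → ι → ℝ) (r : ℝ)
    (hc : ∀ i j k, |x i - x j| < r → |x j - x k| < r → |x i - x k| < r → c i j + c j k = c i k)
    (s : Finset ι) :
    ∃ φ : ι → ℝ, ∀ i ∈ s, ∀ j ∈ s, |x i - x j| < r → c i j = φ j - φ i := by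
  classical
  induction s using Finset.induction_on_max_value x with
  | empty => exact ⟨0, by simp⟩
  | insert a s ha hmax ih =>
    obtain ⟨φ, hφ⟩ := ih
    have hself : ∀ i, 0 < r → c i i = 0 := fun i hr => by
      have := hc i i i (by simpa) (by simpa) (by simpa)
      linarith
    have hsymm : ∀ i j, |x i - x j| < r → c j i = -c i j := fun i j h => by
      have hr : 0 < r := (abs_nonneg _).trans_lt h
      have := hc i j i h (by rwa [abs_sub_comm]) (by simpa)
      linarith [hself i hr]
    have hne : ∀ i ∈ s, i ≠ a := fun i hi h => ha (h ▸ hi)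
    obtain ⟨v, hv⟩ : ∃ v : ℝ, ∀ i ∈ s, |x i - x a| < r → c i a = v - φ i := by
      by_cases hk : ∃ k ∈ s, |x k - x a| < r
      · obtain ⟨k, hks, hk⟩ := hk
        refine ⟨φ k + c k a, fun i hi hia => ?_⟩
        -- As `x a` is maximal, its `r`-neighbours lie in one interval of length `r`, so any one of
        -- them fixes the value at `a`.
        have hik : |x i - x k| < r := by
          have := hmax i hi
          have := hmax k hks
          rw [abs_lt] at *
          constructor <;> linarith
        have := hc i k a hik hk hia
        have := hφ i hi k hks hik
        linarith
      · push Not at hk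
        exact ⟨0, fun i hi h => absurd h (not_lt.2 (hk i hi))⟩
    refine ⟨Function.update φ a v, fun i hi j hj hij => ?_⟩
    rcases Finset.mem_insert.1 hi with rfl | his <;> rcases Finset.mem_insert.1 hj with rfl | hjs
    · rw [hself _ ((abs_nonneg _).trans_lt hij), sub_self]
    · rw [abs_sub_comm] at hij
      rw [Function.update_self, Function.update_of_ne (hne j hjs), hsymm j _ hij, hv j hjs hij]
      ring
    · rw [Function.update_self, Function.update_of_ne (hne i his), hv i his hij]
    · rw [Function.update_of_ne (hne i his), Function.update_of_ne (hne j hjs), hφ i his j hjs hij]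

namespace Circle2Pi

theorem eq_of_coe_eq {s t : ℝ} (h : (s : Circle2Pi) = t) (hst : |s - t| < 2 * π) : s = t := by
  obtain ⟨n, hn⟩ := (AddCircle.coe_eq_zero_iff (2 * π)).1
    (show ((s - t : ℝ) : Circle2Pi) = 0 by rw [AddCircle.coe_sub, h, sub_self])
  rw [← hn, zsmul_eq_mul, abs_mul, abs_of_pos Real.two_pi_pos] at hst
  have h1 : |(n : ℝ)| < 1 := by nlinarith [Real.two_pi_pos]
  have h2 : n = 0 := Int.abs_lt_one_iff.1 (by exact_mod_cast h1)
  rw [h2, zero_smul] at hn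
  linarith

theorem norm_coe_le (s : ℝ) : ‖(s : Circle2Pi)‖ ≤ |s| := by
  simpa using QuotientAddGroup.norm_mk_le_norm (S := AddSubgroup.zmultiples (2 * π)) (m := s)

theorem exists_signed_lift (u : Circle2Pi) : ∃ s : ℝ, (s : Circle2Pi) = u ∧ |s| = ‖u‖ := by
  induction u using QuotientAddGroup.induction_on with
  | H x =>
    refine ⟨x - round ((2 * π)⁻¹ * x) * (2 * π), ?_, (AddCircle.norm_eq (2 * π)).symm⟩
    rw [AddCircle.coe_sub, sub_eq_self, AddCircle.coe_eq_zero_iff]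
    exact ⟨round ((2 * π)⁻¹ * x), by simp⟩

/-- The representative of smallest absolute value of a point of the circle. -/
noncomputable def signedLift (u : Circle2Pi) : ℝ := (exists_signed_lift u).choose

theorem coe_signedLift (u : Circle2Pi) : (signedLift u : Circle2Pi) = u :=
  (exists_signed_lift u).choose_spec.1

theorem abs_signedLift (u : Circle2Pi) : |signedLift u| = ‖u‖ :=
  (exists_signed_lift u).choose_spec.2

theorem signedLift_eq {u : Circle2Pi} {s : ℝ} (h : (s : Circle2Pi) = u)
    (hs : ‖u‖ + |s| < 2 * π) : signedLift u = s := by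
  refine eq_of_coe_eq ((coe_signedLift u).trans h.symm) ((abs_sub _ _).trans_lt ?_)
  rwa [abs_signedLift]

/-- Both sides agree modulo `2 * π` and differ by less than `2 * π`. -/
theorem signedLift_add {u v w : Circle2Pi} (huv : u + v = w) (h : ‖u‖ + ‖v‖ + ‖w‖ < 2 * π) :
    signedLift u + signedLift v = signedLift w := by
  refine (signedLift_eq (by rw [AddCircle.coe_add, coe_signedLift, coe_signedLift, huv]) ?_).symm
  have := abs_add_le (signedLift u) (signedLift v)
  rw [abs_signedLift, abs_signedLift] at this
  linarith

theorem exists_lift_of_le_norm {u : Circle2Pi} {ρ : ℝ} (hu : ρ ≤ ‖u‖) :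
    ∃ s : ℝ, (s : Circle2Pi) = u ∧ ρ ≤ s ∧ s ≤ 2 * π - ρ := by
  have h2 : ‖u‖ ≤ π := by
    have := AddCircle.norm_le_half_period (2 * π) Real.two_pi_pos.ne' (x := u)
    rw [abs_of_pos Real.two_pi_pos] at this
    linarith
  rcases le_total 0 (signedLift u) with h | h
  · have h1 := abs_signedLift u
    rw [abs_of_nonneg h] at h1
    exact ⟨signedLift u, coe_signedLift u, by linarith, by linarith⟩
  · have h1 := abs_signedLift u
    rw [abs_of_nonpos h] at h1
    refine ⟨signedLift u + 2 * π, ?_, by linarith, by linarith⟩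
    rw [AddCircle.coe_add_period, coe_signedLift]

/-- A map of small distortion from a dense enough part of the circle to the circle has an image
that meets every large enough ball. -/
theorem exists_dist_lt_of_distortion {Y : Type*} (y x : Y → Circle2Pi) {b₀ b d : ℝ} (hb : b₀ < b)
    (hbd : b + 2 * d ≤ π / 3)
    (hdist : ∀ p q, |dist (x p) (x q) - dist (y p) (y q)| < 2 * d)
    (hdense : ∀ t, ∃ p, dist t (y p) < b₀) (z : Circle2Pi) : ∃ p, dist (x p) z < b + d := by
  by_contra! hgap
  choose g hg using hdense
  have hd : 0 < d := by
    have := (abs_nonneg _).trans_lt (hdist (g 0) (g 0))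
    linarith
  have hb₀ : 0 < b₀ := dist_nonneg.trans_lt (hg 0)
  simp only [dist_eq_norm _ z] at hgap
  choose l hl hl₁ hl₂ using fun p => exists_lift_of_le_norm (hgap p)
  have hcoe : ∀ p q, ((l p - l q : ℝ) : Circle2Pi) = x p - x q := fun p q => by
    rw [AddCircle.coe_sub, hl, hl, sub_sub_sub_cancel_right]
  have hclose : ∀ p q, |l p - l q| < 2 * (b + d) → dist (y p) (y q) < 2 * π / 3 := fun p q h => by
    have h1 := norm_coe_le (l p - l q)
    rw [hcoe, ← dist_eq_norm] at h1
    have h2 := (abs_lt.1 (hdist p q)).1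
    linarith
  -- The missed ball has diameter `2 * (b + d)`, so close image points cannot be close across it.
  have hclose' : ∀ p q, dist (y p) (y q) < 2 * b → |l p - l q| < 2 * (b + d) := fun p q h => by
    have h1 := (abs_lt.1 (hdist p q)).2
    have h2 : dist (x p) (x q) < 2 * (b + d) := by linarith
    have h3 : |l p - l q| ≤ 2 * π - 2 * (b + d) := by
      rw [abs_le]
      constructor <;> linarith [hl₁ p, hl₁ q, hl₂ p, hl₂ q]
    rw [dist_eq_norm] at h2
    rwa [← signedLift_eq (hcoe p q) (by linarith), abs_signedLift]
  -- Steps below `2 * (b - b₀)`, plus two errors below `b₀`, keep consecutive chain points within `2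
  -- * b`.
  obtain ⟨N, hN⟩ := exists_nat_gt (2 * π / (2 * (b - b₀)))
  have hN₀ : (0 : ℝ) < N := lt_of_le_of_lt
    (div_nonneg Real.two_pi_pos.le (by linarith)) hN
  rw [div_lt_iff₀ (by linarith)] at hN
  have hstep : 2 * π / N < 2 * (b - b₀) := by rwa [div_lt_iff₀' hN₀]
  set t : ℕ → ℝ := fun i => i * (2 * π / N) with ht
  have htN : ((t N : ℝ) : Circle2Pi) = (t 0 : ℝ) := by
    have : t N = t 0 + 2 * π := by simp [ht]; field_simp
    rw [this, AddCircle.coe_add_period]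
  set p : ℕ → Y := fun i => g (t i : ℝ) with hp
  have hpN : p N = p 0 := by simp only [hp, htN]
  set e : ℕ → ℝ := fun i => signedLift (y (p i) - (t i : ℝ)) with he
  have heN : e N = e 0 := by simp only [he, hpN, htN]
  have he_lt : ∀ i, |e i| < b₀ := fun i => by
    rw [he, abs_signedLift, ← dist_eq_norm, dist_comm]
    exact hg _
  have hdiff : ∀ i, |(t (i + 1) + e (i + 1)) - (t i + e i)| < 2 * b := fun i => by
    have h1 := abs_lt.1 (he_lt i)
    have h2 := abs_lt.1 (he_lt (i + 1))
    have h3 : t (i + 1) = t i + 2 * π / N := by simp only [ht]; push_cast; ring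
    have h4 : 0 < 2 * π / N := div_pos Real.two_pi_pos hN₀
    rw [abs_lt, h3]
    constructor <;> linarith
  have hcoe' : ∀ i, ((t (i + 1) + e (i + 1) - (t i + e i) : ℝ) : Circle2Pi)
      = y (p (i + 1)) - y (p i) := fun i => by
    rw [AddCircle.coe_sub, AddCircle.coe_add, AddCircle.coe_add, he, coe_signedLift,
      coe_signedLift, add_sub_cancel, add_sub_cancel]
  have hdy : ∀ i, ‖y (p (i + 1)) - y (p i)‖ < 2 * b := fun i => by
    rw [← hcoe' i]
    exact (norm_coe_le _).trans_lt (hdiff i)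
  classical
  obtain ⟨φ, hφ⟩ := exists_potential l (fun i j => signedLift (y j - y i)) (2 * (b + d))
    (fun i j k hij hjk hik => signedLift_add (by abel) (by
      have h1 := hclose i j hij
      have h2 := hclose j k hjk
      have h3 := hclose i k hik
      rw [dist_comm, dist_eq_norm] at h1 h2 h3
      linarith))
    ((Finset.range (N + 1)).image p)
  have hsum : ∀ i < N, t (i + 1) + e (i + 1) - (t i + e i) = φ (p (i + 1)) - φ (p i) :=
    fun i hi => by
      rw [← hφ (p i) (Finset.mem_image_of_mem _ (by simp; omega)) (p (i + 1))
        (Finset.mem_image_of_mem _ (by simp; omega))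
        (hclose' _ _ (by rw [dist_comm, dist_eq_norm]; exact hdy i))]
      exact (signedLift_eq (hcoe' i) (by linarith [hdy i, hdiff i])).symm
  have h := Finset.sum_congr (rfl : Finset.range N = _)
    (fun i hi => hsum i (Finset.mem_range.1 hi))
  -- Both sums telescope: the left to `2 * π`, the right to `0`.
  rw [Finset.sum_range_sub (fun i => t i + e i), Finset.sum_range_sub (fun i => φ (p i)), hpN,
    heN] at h
  have : t N = 2 * π := by simp only [ht]; field_simp
  have : t 0 = 0 := by simp [ht]
  linarith [Real.pi_pos]

/-- Choosing `d`-near points in a common ambient space gives the map of small distortion. Taking `y`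
to be the identity or an inclusion yields both inequalities. -/
theorem hausdorffEDist_le_of_ghEDist_lt (X : Set Circle2Pi) {Y : Type} [MetricSpace Y]
    {y : Y → Circle2Pi} (hy : Isometry y) {b d : ℝ} (hbd : b + 2 * d ≤ π / 3)
    (hb : hausdorffEDist (range y) univ < ENNReal.ofReal b)
    (hd : ghEDist X Y < ENNReal.ofReal d) :
    hausdorffEDist X univ ≤ ENNReal.ofReal (b + d) := by
  obtain ⟨b₀, hb₀, hb₁⟩ := exists_between hb
  lift b₀ to NNReal using hb₁.ne_top
  have hb₂ : (b₀ : ℝ) < b := by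
    rw [← ENNReal.ofReal_coe_nnreal] at hb₁
    exact (ENNReal.ofReal_lt_ofReal_iff_of_nonneg b₀.coe_nonneg).1 hb₁
  simp only [ghEDist, iInf_lt_iff] at hd
  obtain ⟨Z, _, γ, ψ, hγ, hψ, hd⟩ := hd
  have hx : ∀ p : Y, ∃ x : X, dist (γ x) (ψ p) < d := fun p => by
    obtain ⟨_, ⟨x, rfl⟩, hx⟩ := exists_edist_lt_of_hausdorffEDist_lt (mem_range_self p)
      (by rwa [hausdorffEDist_comm] at hd)
    refine ⟨x, ?_⟩
    rw [edist_comm, edist_dist] at hx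
    exact (ENNReal.ofReal_lt_ofReal_iff_of_nonneg dist_nonneg).1 hx
  choose x hx using hx
  have hdense : ∀ t, ∃ p, dist t (y p) < b₀ := fun t => by
    obtain ⟨_, ⟨p, rfl⟩, hp⟩ := exists_edist_lt_of_hausdorffEDist_lt (mem_univ t)
      (by rwa [hausdorffEDist_comm] at hb₀)
    refine ⟨p, ?_⟩
    rw [edist_dist, ← ENNReal.ofReal_coe_nnreal] at hp
    exact (ENNReal.ofReal_lt_ofReal_iff_of_nonneg dist_nonneg).1 hp
  refine hausdorffEDist_le_of_mem_edist (fun p _ => ⟨p, mem_univ p, by simp⟩) fun z _ => ?_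
  obtain ⟨p, hp⟩ := exists_dist_lt_of_distortion y (fun p => (x p : Circle2Pi)) hb₂ hbd
    (fun p q => by
      rw [← Subtype.dist_eq, ← hγ.dist_eq, hy.dist_eq, ← hψ.dist_eq, abs_lt]
      have h1 := dist_triangle4 (γ (x p)) (ψ p) (ψ q) (γ (x q))
      have h2 := dist_triangle4 (ψ p) (γ (x p)) (γ (x q)) (ψ q)
      have h3 := hx p
      have h4 := hx q
      rw [dist_comm (ψ q)] at h1
      rw [dist_comm (ψ p) (γ (x p))] at h2
      constructor <;> linarith)
    hdense z
  refine ⟨x p, (x p).2, ?_⟩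
  rw [edist_comm, edist_dist]
  exact ENNReal.ofReal_le_ofReal hp.le

end Circle2Pi

theorem ghEDist_le_hausdorffEDist (X : Set Circle2Pi) :
    ghEDist X Circle2Pi ≤ hausdorffEDist X univ := by
  rw [ghEDist]
  refine iInf_le_of_le Circle2Pi <| iInf_le_of_le inferInstance <|
    iInf_le_of_le Subtype.val <| iInf_le_of_le id <| iInf_le_of_le isometry_subtype_coe <|
    iInf_le_of_le isometry_id ?_
  rw [Subtype.range_coe, range_id]

theorem min_hausdorffEDist_le_ghEDist (X : Set Circle2Pi) :
    min (hausdorffEDist X univ) (ENNReal.ofReal (π / 6)) ≤ ghEDist X Circle2Pi := by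
  by_contra! h
  obtain ⟨d, hd, hd'⟩ := exists_between h
  obtain ⟨c, hc, hc'⟩ := exists_between hd'
  lift d to NNReal using hd'.ne_top
  lift c to NNReal using hc'.ne_top
  have hcd : (d : ℝ) < c := by exact_mod_cast hc
  have hc₆ : (c : ℝ) < π / 6 := by
    have := hc'.trans_le (min_le_right _ _)
    rw [← ENNReal.ofReal_coe_nnreal] at this
    exact (ENNReal.ofReal_lt_ofReal_iff_of_nonneg c.coe_nonneg).1 this
  -- Any `b > 0` is admissible for the full circle; this one makes `b + d = c` and `b + 2 * d = c +
  -- d < π / 3`.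
  have := Circle2Pi.hausdorffEDist_le_of_ghEDist_lt X (isometry_id (α := Circle2Pi))
    (b := c - d) (d := d) (by linarith)
    (by rw [range_id, hausdorffEDist_self]; simpa using hcd) (by simpa using hd)
  rw [sub_add_cancel, ENNReal.ofReal_coe_nnreal] at this
  exact (hc'.trans_le (min_le_left _ _)).not_ge this

theorem min_sub_hausdorffEDist_le_ghEDist (X Y : Set Circle2Pi) :
    min ((hausdorffEDist X univ : EReal) - (hausdorffEDist Y univ : EReal))
        (((π / 6 : ℝ) : EReal) - ((hausdorffEDist Y univ / 2 : ℝ≥0∞) : EReal))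
      ≤ (ghEDist X Y : EReal) := by
  by_contra! h
  obtain ⟨h₁, h₂⟩ := lt_min_iff.1 h
  have hB : hausdorffEDist Y univ ≠ ⊤ := fun hB => by
    rw [hB, ENNReal.top_div_of_ne_top (by simp)] at h₂
    simp at h₂
  have hD : ghEDist X Y ≠ ⊤ := fun hD => by
    rw [hD] at h₂
    simp at h₂
  -- The slack `ε` is shared equally between `b` and `d` below.
  have hdiff : ∃ ε : ℝ, 0 < ε ∧
      (ghEDist X Y).toReal + (hausdorffEDist Y univ).toReal / 2 + ε ≤ π / 6 ∧
      ENNReal.ofReal ((ghEDist X Y).toReal + (hausdorffEDist Y univ).toReal + ε) <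
        hausdorffEDist X univ := by
    generalize hausdorffEDist X univ = A at *
    generalize ghEDist X Y = D at *
    generalize hausdorffEDist Y univ = B at *
    lift B to NNReal using hB
    lift D to NNReal using hD
    have h₃ : (D : ℝ) < π / 6 - B / 2 := by
      have : ((B : ℝ≥0∞) / 2) = ((B / 2 : NNReal) : ℝ≥0∞) := by simp
      rw [this] at h₂
      change ((D : ℝ) : EReal) < (π / 6 : ℝ) - (((B / 2 : NNReal) : ℝ) : EReal) at h₂
      exact_mod_cast h₂
    by_cases hA : A = ⊤
    · refine ⟨π / 6 - B / 2 - D, by linarith, by simp only [ENNReal.coe_toReal]; linarith, ?_⟩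
      rw [hA]
      exact ENNReal.ofReal_lt_top
    lift A to NNReal using hA
    have h₄ : (D : ℝ) < A - B := by
      change ((D : ℝ) : EReal) < ((A : ℝ) : EReal) - ((B : ℝ) : EReal) at h₁
      exact_mod_cast h₁
    refine ⟨min (π / 6 - B / 2 - D) ((A - B - D) / 2), lt_min (by linarith) (by linarith), ?_, ?_⟩
    · have := min_le_left (π / 6 - B / 2 - D) ((A - B - D : ℝ) / 2)
      simp only [ENNReal.coe_toReal]
      linarith
    · have := min_le_right (π / 6 - B / 2 - D) ((A - B - D : ℝ) / 2)
      rw [← ENNReal.ofReal_coe_nnreal (p := A)]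
      simp only [ENNReal.coe_toReal]
      refine (ENNReal.ofReal_lt_ofReal_iff ?_).2 ?_ <;>
        linarith [show (0 : ℝ) ≤ D from D.coe_nonneg, show (0 : ℝ) ≤ B from B.coe_nonneg]
  obtain ⟨ε, hε, h₃, h₄⟩ := hdiff
  refine h₄.not_ge ?_
  have key := Circle2Pi.hausdorffEDist_le_of_ghEDist_lt X (isometry_subtype_coe (s := Y))
    (b := (hausdorffEDist Y univ).toReal + ε / 2) (d := (ghEDist X Y).toReal + ε / 2)
    (by linarith)
    (by rw [Subtype.range_coe, ENNReal.lt_ofReal_iff_toReal_lt hB]; linarith)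
    (by rw [ENNReal.lt_ofReal_iff_toReal_lt hD]; linarith)
  rwa [add_add_add_comm, add_halves, add_comm (ENNReal.toReal _)] at key

theorem mainTheorem2 (X Y : Set Circle2Pi) :
    min (hausdorffEDist X univ) (ENNReal.ofReal (π / 6)) ≤ ghEDist X Circle2Pi ∧
    min ((hausdorffEDist X univ : EReal) - (hausdorffEDist Y univ : EReal))
        (((π / 6 : ℝ) : EReal) - ((hausdorffEDist Y univ / 2 : ℝ≥0∞) : EReal))
      ≤ (ghEDist X Y : EReal) ∧
    (ghEDist X Circle2Pi < ENNReal.ofReal (π / 6) →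
      ghEDist X Circle2Pi = hausdorffEDist X univ) := by
  refine ⟨min_hausdorffEDist_le_ghEDist X, min_sub_hausdorffEDist_le_ghEDist X Y, fun h => ?_⟩
  refine (ghEDist_le_hausdorffEDist X).antisymm ?_
  exact (min_le_iff.1 (min_hausdorffEDist_le_ghEDist X)).resolve_right h.not_ge
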